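/- Let $\lfloor\cdot\rfloor:\mathbb C\setminus\{0\}\to\mathbb Z[i]$ be a choice function, that is, a function with $|z-\lfloor z\rfloor|\le 1$ for all $z\neq 0$. Let $K=\overline{\{z-\lfloor z\rfloor : z\in\mathbb C\setminus\{0\}\}}$ be its fundamental set, and let $G$ be its Gauss map, $G(z)=-1/z-\lfloor -1/z\rfloor$ for $z\ne0$ and $G(0)=0$. Write $\hat{\mathbb C}=\mathbb C\cup\{\infty\}$ for the Riemann sphere, and for $z\in\mathbb C\setminus\{0\}$ and $w\in\hat{\mathbb C}$ put $$\hat G(z,w)=\Big(-\tfrac1z-a,\;-\tfrac1w-a\Big),\qquad a=\lfloor -1/z\rfloor,$$ with the usual conventions $-1/0=\infty$, $-1/\infty=0$, $\infty-a=\infty$ in the second coordinate. Let $z\in K\setminus\mathbb Q(i)$ and $w\in\mathbb C$ with $z\neq w$, and assume that the orbit of $z$ does not eventually stay on the unit circle, that is, there is no $m$ such that $|G^n(z)|=1$ for all $n\ge m$. Then there exists an integer $n\ge 0$ such that $\hat G^n(z,w)\in K\times(\mathbb C\setminus\overline{\mathbb D})$, where $\overline{\mathbb D}$ is the closed unit disk;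 in particular, the second coordinate of $\hat G^n(z,w)$ is finite. -/

import Mathlib

noncomputable section

namespace ComplexCF

/-- A choice function assigns to every nonzero complex number a Gaussian integer at distance
at most `1` from it. (The value of `f` at `0` is irrelevant and is never used.) -/
def IsChoiceFunction (f : ℂ → GaussianInt) : Prop :=
  ∀ z : ℂ, z ≠ 0 → ‖z - (f z : ℂ)‖ ≤ 1

/-- The fundamental set `K` of a choice function. -/
def fundamentalSet (f : ℂ → GaussianInt) : Set ℂ :=
  closure {x : ℂ | ∃ z : ℂ, z ≠ 0 ∧ x = z - (f z : ℂ)}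

open Classical in
/-- The Gauss map `G(z) = -1/z - ⌊-1/z⌋` for `z ≠ 0`, and `G(0) = 0`. -/
def gaussMap (f : ℂ → GaussianInt) (z : ℂ) : ℂ :=
  if z = 0 then 0 else -1 / z - (f (-1 / z) : ℂ)

/-- A complex number is rational if its real and imaginary parts are rational. -/
def IsRational (z : ℂ) : Prop :=
  ∃ r s : ℚ, z = (r : ℂ) + (s : ℂ) * Complex.I

open Classical in
/-- The inversion `S(w) = -1/w` of the Riemann sphere, with `S(0) = ∞` and `S(∞) = 0`. -/
def sphereS (w : OnePoint ℂ) : OnePoint ℂ :=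
  OnePoint.elim w ((0 : ℂ) : OnePoint ℂ)
    (fun x : ℂ => if x = 0 then OnePoint.infty else ((-1 / x : ℂ) : OnePoint ℂ))

/-- The translation `T^b(w) = w + b` of the Riemann sphere, with `T^b(∞) = ∞`. -/
def sphereT (b : ℂ) (w : OnePoint ℂ) : OnePoint ℂ :=
  OnePoint.map (fun x : ℂ => x + b) w

/-- The natural extension `(z, w) ↦ (T^{-a} S z, T^{-a} S w)`, `a = ⌊S z⌋`, of the Gauss map
(meaningful for `z ≠ 0`). The second coordinate lives on the Riemann sphere, so that the map can
also be applied at `w = 0`. -/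
def naturalExtension (f : ℂ → GaussianInt) (p : ℂ × OnePoint ℂ) : ℂ × OnePoint ℂ :=
  (gaussMap f p.1, sphereT (-(f (-1 / p.1) : ℂ)) (sphereS p.2))

/-- The orbit of `z` under the Gauss map does not eventually stay on the unit circle. -/
def IsNondegenerate (f : ℂ → GaussianInt) (z : ℂ) : Prop :=
  ¬ ∃ m : ℕ, ∀ n : ℕ, m ≤ n → ‖(gaussMap f)^[n] z‖ = 1

end ComplexCF

end

namespace ComplexCF

/-! Write `L n x = q n * x - p n` for the linear forms of the convergents of `z`. Then `L (n+1) z =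
G^n(z) * L n z`, and the second coordinate of the `n`-th iterate is `L (n+1) w / L n w`. If the
orbit never meets the target set, both `L n z` and `L n w` stay bounded by `1`. Their difference is
`q n * (z - w)`, so the Gaussian integers `q n` and `p n` take only finitely many values, and so
does the non-increasing sequence `‖L n z‖`. It is therefore eventually constant, and nonzero, which
forces `|G^n(z)| = 1` from some point on. -/

/-- The solution of the three-term recurrence `x (n + 2) = -x n - b n * x (n + 1)` with initial
values `x 0 = s` and `x 1 = t`. -/
def continuant (b : ℕ → GaussianInt) (s t : GaussianInt) : ℕ → GaussianInt
  | 0 => s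
  | 1 => t
  | n + 2 => -continuant b s t n - b n * continuant b s t (n + 1)

/-- The linear form `q n * x - p n` attached to the convergents `p n / q n` with digits `b`. -/
noncomputable def convergentForm (b : ℕ → GaussianInt) (x : ℂ) (n : ℕ) : ℂ :=
  (continuant b 0 1 n : ℂ) * x - (continuant b (-1) 0 n : ℂ)

theorem convergentForm_zero (b : ℕ → GaussianInt) (x : ℂ) : convergentForm b x 0 = 1 := by
  simp [convergentForm, continuant]

theorem convergentForm_one (b : ℕ → GaussianInt) (x : ℂ) : convergentForm b x 1 = x := by
  simp [convergentForm, continuant]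

theorem convergentForm_add_two (b : ℕ → GaussianInt) (x : ℂ) (n : ℕ) :
    convergentForm b x (n + 2) =
      -convergentForm b x n - (b n : ℂ) * convergentForm b x (n + 1) := by
  simp only [convergentForm, continuant, map_sub, map_neg, map_mul]
  ring

theorem finite_setOf_norm_toComplex_le (C : ℝ) :
    {x : GaussianInt | ‖(x : ℂ)‖ ≤ C}.Finite := by
  have hfin : ((Set.Icc (-⌈C⌉) ⌈C⌉) ×ˢ (Set.Icc (-⌈C⌉) ⌈C⌉) : Set (ℤ × ℤ)).Finite :=
    (Set.finite_Icc _ _).prod (Set.finite_Icc _ _)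
  have hinj : Function.Injective (fun x : GaussianInt => (x.re, x.im)) := by
    intro x y h
    simp only [Prod.mk.injEq] at h
    exact Zsqrtd.ext h.1 h.2
  refine (hfin.preimage hinj.injOn).subset fun x hx => ?_
  have key : ∀ k : ℤ, |(k : ℝ)| ≤ C → k ∈ Set.Icc (-⌈C⌉) ⌈C⌉ := by
    intro k hk
    have h : |k| ≤ ⌈C⌉ := by
      have := hk.trans (Int.le_ceil C)
      exact_mod_cast this
    exact abs_le.mp h
  have hre := (Complex.abs_re_le_norm (x : ℂ)).trans hx
  have him := (Complex.abs_im_le_norm (x : ℂ)).trans hx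
  rw [← GaussianInt.intCast_re] at hre
  rw [← GaussianInt.intCast_im] at him
  exact ⟨key _ hre, key _ him⟩

theorem exists_forall_ge_eq_of_antitone {u : ℕ → ℝ} (hu : Antitone u)
    (hfin : (Set.range u).Finite) : ∃ m, ∀ n, m ≤ n → u n = u m := by
  obtain ⟨_, ⟨m, rfl⟩, hm⟩ := Set.exists_min_image _ id hfin (Set.range_nonempty u)
  exact ⟨m, fun n hn => le_antisymm (hu hn) (hm _ ⟨n, rfl⟩)⟩

/-- Subtracting the two forms eliminates `p n` and bounds `q n`; then `p n` is bounded too, and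
bounded sets of Gaussian integers are finite. -/
theorem finite_range_convergentForm {b : ℕ → GaussianInt} {z w : ℂ} (hzw : z ≠ w) {A B : ℝ}
    (hz : ∀ n, ‖convergentForm b z n‖ ≤ A) (hw : ∀ n, ‖convergentForm b w n‖ ≤ B) :
    (Set.range (convergentForm b z)).Finite := by
  have hpos : 0 < ‖z - w‖ := norm_pos_iff.mpr (sub_ne_zero.mpr hzw)
  have hq : ∀ n, ‖(continuant b 0 1 n : ℂ)‖ ≤ (A + B) / ‖z - w‖ := by
    intro n
    rw [le_div_iff₀ hpos, ← norm_mul]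
    have h : (continuant b 0 1 n : ℂ) * (z - w) = convergentForm b z n - convergentForm b w n := by
      simp only [convergentForm]
      ring
    rw [h]
    exact (norm_sub_le _ _).trans (add_le_add (hz n) (hw n))
  have hp : ∀ n, ‖(continuant b (-1) 0 n : ℂ)‖ ≤ (A + B) / ‖z - w‖ * ‖z‖ + A := by
    intro n
    have h : (continuant b (-1) 0 n : ℂ) = (continuant b 0 1 n : ℂ) * z - convergentForm b z n := by
      simp only [convergentForm]
      ring
    rw [h]
    refine (norm_sub_le _ _).trans (add_le_add ?_ (hz n))
    rw [norm_mul]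
    exact mul_le_mul_of_nonneg_right (hq n) (norm_nonneg z)
  refine (((finite_setOf_norm_toComplex_le ((A + B) / ‖z - w‖)).prod
    (finite_setOf_norm_toComplex_le ((A + B) / ‖z - w‖ * ‖z‖ + A))).image
    (fun x : GaussianInt × GaussianInt => (x.1 : ℂ) * z - (x.2 : ℂ))).subset ?_
  rintro _ ⟨n, rfl⟩
  exact ⟨(continuant b 0 1 n, continuant b (-1) 0 n), ⟨hq n, hp n⟩, rfl⟩

theorem isRational_zero : IsRational 0 := ⟨0, 0, by simp⟩

theorem IsRational.add_gaussianInt {z : ℂ} (hz : IsRational z) (a : GaussianInt) :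
    IsRational (z + (a : ℂ)) := by
  obtain ⟨r, s, rfl⟩ := hz
  refine ⟨r + a.re, s + a.im, ?_⟩
  rw [GaussianInt.toComplex_def]
  push_cast
  ring

theorem IsRational.neg_one_div {z : ℂ} (hz : IsRational z) : IsRational (-1 / z) := by
  obtain ⟨r, s, rfl⟩ := hz
  refine ⟨-r / (r ^ 2 + s ^ 2), s / (r ^ 2 + s ^ 2), ?_⟩
  apply Complex.ext
  · simp [Complex.normSq_apply, ← Complex.ofReal_ratCast,
      ← Complex.ofReal_pow, ← Complex.ofReal_add, ← Complex.ofReal_div, ← Complex.ofReal_neg,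
      ← sq, neg_div]
  · simp [Complex.normSq_apply, ← Complex.ofReal_ratCast,
      ← Complex.ofReal_pow, ← Complex.ofReal_add, ← Complex.ofReal_div, ← Complex.ofReal_neg,
      ← sq, neg_div]

theorem gaussMap_of_ne_zero (f : ℂ → GaussianInt) {z : ℂ} (hz : z ≠ 0) :
    gaussMap f z = -1 / z - (f (-1 / z) : ℂ) := if_neg hz

theorem not_isRational_gaussMap (f : ℂ → GaussianInt) {z : ℂ} (hz : ¬ IsRational z) :
    ¬ IsRational (gaussMap f z) := by
  intro h
  have hz0 : z ≠ 0 := fun h0 => hz (h0 ▸ isRational_zero)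
  rw [gaussMap_of_ne_zero f hz0] at h
  have h2 := (h.add_gaussianInt (f (-1 / z))).neg_one_div
  rw [sub_add_cancel] at h2
  apply hz
  convert h2 using 1
  field_simp

theorem not_isRational_iterate_gaussMap (f : ℂ → GaussianInt) {z : ℂ} (hz : ¬ IsRational z)
    (n : ℕ) : ¬ IsRational ((gaussMap f)^[n] z) := by
  induction n with
  | zero => exact hz
  | succ n ih =>
    rw [Function.iterate_succ_apply']
    exact not_isRational_gaussMap f ih

theorem gaussMap_mem_fundamentalSet (f : ℂ → GaussianInt) {z : ℂ} (hz : z ≠ 0) :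
    gaussMap f z ∈ fundamentalSet f :=
  subset_closure ⟨-1 / z, div_ne_zero (neg_ne_zero.mpr one_ne_zero) hz, gaussMap_of_ne_zero f hz⟩

theorem IsChoiceFunction.norm_le_one {f : ℂ → GaussianInt} (hf : IsChoiceFunction f) {z : ℂ}
    (hz : z ∈ fundamentalSet f) : ‖z‖ ≤ 1 := by
  have h : fundamentalSet f ⊆ Metric.closedBall 0 1 := by
    refine closure_minimal ?_ Metric.isClosed_closedBall
    rintro _ ⟨x, hx, rfl⟩
    exact mem_closedBall_zero_iff.mpr (hf x hx)
  exact mem_closedBall_zero_iff.mp (h hz)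

/-- The digits of the continued fraction expansion of `z`. -/
noncomputable def digit (f : ℂ → GaussianInt) (z : ℂ) (n : ℕ) : GaussianInt := f (-1 / (gaussMap f)^[n] z)

theorem iterate_gaussMap_mem_fundamentalSet {f : ℂ → GaussianInt} {z : ℂ}
    (hz : z ∈ fundamentalSet f) (hne : ∀ n, (gaussMap f)^[n] z ≠ 0) (n : ℕ) :
    (gaussMap f)^[n] z ∈ fundamentalSet f := by
  cases n with
  | zero => exact hz
  | succ n =>
    rw [Function.iterate_succ_apply']
    exact gaussMap_mem_fundamentalSet f (hne n)

theorem convergentForm_digit_succ (f : ℂ → GaussianInt) {z : ℂ}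
    (hne : ∀ n, (gaussMap f)^[n] z ≠ 0) (n : ℕ) :
    convergentForm (digit f z) z (n + 1) =
      (gaussMap f)^[n] z * convergentForm (digit f z) z n := by
  induction n with
  | zero => simp [convergentForm_zero, convergentForm_one]
  | succ n ih =>
    rw [convergentForm_add_two, Function.iterate_succ_apply', gaussMap_of_ne_zero f (hne n), ih]
    have := hne n
    simp only [digit]
    field_simp

theorem convergentForm_digit_ne_zero (f : ℂ → GaussianInt) {z : ℂ}
    (hne : ∀ n, (gaussMap f)^[n] z ≠ 0) (n : ℕ) : convergentForm (digit f z) z n ≠ 0 := by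
  induction n with
  | zero => simp [convergentForm_zero]
  | succ n ih =>
    rw [convergentForm_digit_succ f hne]
    exact mul_ne_zero (hne n) ih

theorem iterate_naturalExtension_fst (f : ℂ → GaussianInt) (p : ℂ × OnePoint ℂ) (n : ℕ) :
    ((naturalExtension f)^[n] p).1 = (gaussMap f)^[n] p.1 := by
  induction n with
  | zero => rfl
  | succ n ih => rw [Function.iterate_succ_apply', Function.iterate_succ_apply', ← ih]; rfl

/-- The ratio of two complex numbers as a point of the Riemann sphere. -/
noncomputable def sphereRatio (x y : ℂ) : OnePoint ℂ :=
  open Classical in if y = 0 then OnePoint.infty else ((x / y : ℂ) : OnePoint ℂ)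

theorem sphereT_sphereS_sphereRatio (b x y : ℂ) (h : x ≠ 0 ∨ y ≠ 0) :
    sphereT b (sphereS (sphereRatio x y)) = sphereRatio (-y + b * x) x := by
  by_cases hy : y = 0
  · have hx : x ≠ 0 := h.resolve_right (not_not_intro hy)
    simp [sphereRatio, sphereS, sphereT, hy, hx]
  · by_cases hx : x = 0
    · simp [sphereRatio, sphereS, sphereT, hy, hx]
    · simp only [sphereRatio, sphereS, sphereT, hy, hx, if_false, OnePoint.elim_some,
        div_eq_zero_iff, or_self, OnePoint.map_some]
      congr 1
      field_simp

/-- Two consecutive zeros would propagate back to the initial value `1`. Hence the ratio on the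
sphere is never `0/0`. -/
theorem convergentForm_ne_zero_or (b : ℕ → GaussianInt) (w : ℂ) (n : ℕ) :
    convergentForm b w (n + 1) ≠ 0 ∨ convergentForm b w n ≠ 0 := by
  induction n with
  | zero => simp [convergentForm_zero]
  | succ n ih =>
    by_contra! h
    obtain ⟨h1, h2⟩ := h
    rw [convergentForm_add_two, h2, mul_zero, sub_zero, neg_eq_zero] at h1
    exact ih.elim (· h2) (· h1)

theorem iterate_naturalExtension_snd (f : ℂ → GaussianInt) (z w : ℂ) (n : ℕ) :
    ((naturalExtension f)^[n] (z, (w : OnePoint ℂ))).2 =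
      sphereRatio (convergentForm (digit f z) w (n + 1)) (convergentForm (digit f z) w n) := by
  induction n with
  | zero => simp [sphereRatio, convergentForm_zero, convergentForm_one]
  | succ n ih =>
    rw [Function.iterate_succ_apply', naturalExtension]
    simp only [ih, iterate_naturalExtension_fst]
    rw [sphereT_sphereS_sphereRatio _ _ _ (convergentForm_ne_zero_or _ _ _),
      convergentForm_add_two]
    congr 1
    rw [digit]
    ring

/-- The hypothesis says nothing after a zero, where the ratio is `∞`; there the recurrence gives `L
(n+2) = -L n`, so the bound survives. -/
theorem norm_convergentForm_le_one {b : ℕ → GaussianInt} {w : ℂ}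
    (h : ∀ n, convergentForm b w n ≠ 0 → ‖convergentForm b w (n + 1)‖ ≤ ‖convergentForm b w n‖)
    (n : ℕ) : ‖convergentForm b w n‖ ≤ 1 := by
  induction n using Nat.strong_induction_on with
  | _ n ih =>
    match n with
    | 0 => simp [convergentForm_zero]
    | 1 => simpa [convergentForm_zero] using h 0 (by simp [convergentForm_zero])
    | n + 2 =>
      by_cases h0 : convergentForm b w (n + 1) = 0
      · rw [convergentForm_add_two, h0, mul_zero, sub_zero, norm_neg]
        exact ih n (by omega)
      · exact (h (n + 1) h0).trans (ih (n + 1) (by omega))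

end ComplexCF

open ComplexCF in
theorem mainTheorem6 (f : ℂ → GaussianInt) (hf : ComplexCF.IsChoiceFunction f)
    (z w : ℂ) (hzK : z ∈ ComplexCF.fundamentalSet f) (hz : ¬ ComplexCF.IsRational z)
    (hnd : ComplexCF.IsNondegenerate f z) (hzw : z ≠ w) :
    ∃ n : ℕ, (ComplexCF.naturalExtension f)^[n] (z, (w : OnePoint ℂ)) ∈
      ComplexCF.fundamentalSet f ×ˢ
        ((fun x : ℂ => (x : OnePoint ℂ)) '' (Metric.closedBall (0 : ℂ) 1)ᶜ) := by
  have hne : ∀ n, (gaussMap f)^[n] z ≠ 0 := fun n h0 =>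
    not_isRational_iterate_gaussMap f hz n (h0 ▸ isRational_zero)
  have hK := iterate_gaussMap_mem_fundamentalSet hzK hne
  by_contra! hcon
  have hw : ∀ n, ‖convergentForm (digit f z) w n‖ ≤ 1 := by
    refine norm_convergentForm_le_one fun n hn => ?_
    -- A strict increase from a nonzero value is a finite ratio of modulus greater than `1`, which
    -- is the point sought.
    by_contra! hlt
    refine hcon n ⟨?_, ?_⟩
    · rw [iterate_naturalExtension_fst]
      exact hK n
    · rw [iterate_naturalExtension_snd, sphereRatio, if_neg hn]
      refine ⟨_, ?_, rfl⟩
      rw [Set.mem_compl_iff, mem_closedBall_zero_iff, not_le, norm_div,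
        one_lt_div (norm_pos_iff.mpr hn)]
      exact hlt
  have hanti : Antitone fun n => ‖convergentForm (digit f z) z n‖ := by
    refine antitone_nat_of_succ_le fun n => ?_
    rw [convergentForm_digit_succ f hne, norm_mul]
    exact mul_le_of_le_one_left (norm_nonneg _) (hf.norm_le_one (hK n))
  have hz1 : ∀ n, ‖convergentForm (digit f z) z n‖ ≤ 1 := fun n => by
    simpa [convergentForm_zero] using hanti (Nat.zero_le n)
  have hfin : (Set.range fun n => ‖convergentForm (digit f z) z n‖).Finite := by
    have := (finite_range_convergentForm hzw hz1 hw).image norm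
    rwa [← Set.range_comp] at this
  obtain ⟨m, hm⟩ := exists_forall_ge_eq_of_antitone hanti hfin
  refine hnd ⟨m, fun n hn => ?_⟩
  have h1 : ‖convergentForm (digit f z) z (n + 1)‖ = ‖convergentForm (digit f z) z n‖ :=
    (hm (n + 1) (by omega)).trans (hm n hn).symm
  rw [convergentForm_digit_succ f hne, norm_mul] at h1
  exact (mul_eq_right₀ (norm_ne_zero_iff.mpr (convergentForm_digit_ne_zero f hne n))).mp h1
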